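/- Let $H$ be an abelian group. Say that a group is \emph{arithmetically linear} if it is isomorphic to a subgroup of $\mathrm{GL}_n(C)$ for some integer $n \ge 0$ and some finitely generated commutative $\mathbb{Z}$-algebra $C$. Say that an abelian group $B$ is \emph{bounded} if $nB = 0$ for some positive integer $n$, and that an abelian group is \emph{cobounded} if, for some positive integer $n$, it is isomorphic to a subgroup of a direct sum of (possibly infinitely many) copies of the additive group of $\mathbb{Z}[1/n]$. Then $H$ is arithmetically linear if and only if $H$ is countable (finite or countably infinite) and $H \cong B \times C$ for some bounded abelian group $B$ and some cobounded abelian group $C$. -/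

import Mathlib

universe u v

/-- A group is arithmetically linear if it embeds as a subgroup of `GL_n(C)` for some `n` and some
finitely generated commutative `ℤ`-algebra `C`. -/
def IsArithmeticallyLinear (G : Type u) [Group G] : Prop :=
  ∃ (n : ℕ) (C : Type v) (_ : CommRing C), Algebra.FiniteType ℤ C ∧
    ∃ f : G →* Matrix.GeneralLinearGroup (Fin n) C, Function.Injective f

/-- An abelian group `B` is bounded if `n B = 0` for some positive integer `n`. -/
def IsBoundedAddGroup (B : Type u) [AddCommGroup B] : Prop :=
  ∃ n : ℕ, 0 < n ∧ ∀ b : B, n • b = 0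

/-- An abelian group is cobounded if, for some positive integer `n`, it embeds in a direct sum of
(possibly infinitely many) copies of `ℤ[1/n]`. -/
def IsCoboundedAddGroup (A : Type u) [AddCommGroup A] : Prop :=
  ∃ n : ℕ, 0 < n ∧ ∃ (ι : Type u) (f : A →+ (ι →₀ Localization.Away (n : ℤ))),
    Function.Injective f

/-- An abelian group is bounded × cobounded if it is isomorphic to `B × C` with `B` bounded and
`C` cobounded. -/
def IsBoundedTimesCobounded (H : Type u) [AddCommGroup H] : Prop :=
  ∃ (B C : Type u) (_ : AddCommGroup B) (_ : AddCommGroup C),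
    IsBoundedAddGroup B ∧ IsCoboundedAddGroup C ∧ Nonempty (H ≃+ B × C)

/-!
Commuting matrices over `C` generate a commutative subalgebra `A` that is finite over `C`, so an
arithmetically linear abelian group embeds in the unit group of a finitely generated commutative
ring `A`. Extensions of cobounded groups by bounded ones are stable under subgroups and under
further extensions, because over a localization `R` of `ℤ`, which is a principal ideal domain, the
kernel of a homomorphism into a free `R`-module has the extension property for homomorphisms into
`R`-modules. Moreover a bounded subgroup with torsion-free quotient is a direct summand. It
therefore suffices to filter `Aˣ` by such extensions. The powers of the nilradical contribute
subquotients of additive groups of finitely generated rings, and the units of the reduced quotient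
embed in the product of the unit groups of the fraction fields of `A / p` for the minimal primes
`p`.

* Additive groups: an ideal of `ℤ[X₁, …, Xₙ]` has finitely many minimal leading monomials; once the
  leading coefficients of polynomials realizing them are inverted, the quotient by the ideal is free
  on the remaining monomials. By noetherianity, the torsion killed by inverting them is bounded.
* Fields: adjoin the generators one at a time. For `L` finite and separable over `k(t)`, the
  divisors over `k[t]` and `k[t⁻¹]` map `Lˣ` to a free abelian group; an element of the kernel is
  integral over both rings, hence algebraic over `k`. The induction starts from finite fields and
  from number fields, where Dirichlet's unit theorem applies.

Conversely, a countable bounded group embeds in `(ℤ/n)[X]`, a countable cobounded group embeds in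
`ℤ[1/m][X]`, and the additive group of a ring is a group of unipotent `2 × 2` matrices.
-/

section FreeSubmodules

theorem linearIndependent_of_support_le {R ι κ : Type*} [CommRing R] [IsDomain R] [LinearOrder ι]
    {v : κ → ι →₀ R} {e : κ → ι} (he : Function.Injective e)
    (hsupp : ∀ k, v k ∈ Finsupp.supported R R (Set.Iic (e k))) (hlead : ∀ k, v k (e k) ≠ 0) :
    LinearIndependent R v := by
  rw [linearIndependent_iff]
  intro l hl
  by_contra hne
  obtain ⟨k, hk, hmax⟩ := l.support.exists_max_image e (Finsupp.support_nonempty_iff.mpr hne)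
  have hvanish : ∀ i ∈ l.support, i ≠ k → l i * v i (e k) = 0 := by
    intro i hi hik
    have hlt : e i < e k := lt_of_le_of_ne (hmax i hi) (he.ne hik)
    rw [Finsupp.notMem_support_iff.mp fun h => hlt.not_ge ((hsupp i) h), mul_zero]
  have hcoeff : l k * v k (e k) = 0 := by
    rw [← l.support.sum_eq_single_of_mem k hk hvanish]
    simpa [Finsupp.linearCombination_apply, Finsupp.sum, Finsupp.finsetSum_apply] using
      DFunLike.congr_fun hl (e k)
  exact mul_ne_zero (Finsupp.mem_support_iff.mp hk) (hlead k) hcoeff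

variable {R ι : Type*} [CommRing R]

/-- The ideal of leading coefficients at `i` of a submodule of `ι →₀ R`: the `i`-th coordinates of
those elements whose coordinates above `i` vanish. -/
noncomputable def leadingIdeal [Preorder ι] (P : Submodule R (ι →₀ R)) (i : ι) : Ideal R :=
  (P ⊓ Finsupp.supported R R (Set.Iic i)).map (Finsupp.lapply i)

theorem eq_of_leadingIdeal_le [LinearOrder ι] [WellFoundedLT ι] {P N : Submodule R (ι →₀ R)}
    (hNP : N ≤ P) (hlead : ∀ i, leadingIdeal P i ≤ leadingIdeal N i) : N = P := by
  refine le_antisymm hNP fun x hx => ?_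
  suffices h : ∀ i, ∀ x ∈ P, x ∈ Finsupp.supported R R (Set.Iic i) → x ∈ N by
    rcases eq_or_ne x 0 with rfl | hx0
    · exact N.zero_mem
    · exact h (x.support.max' (Finsupp.support_nonempty_iff.mpr hx0)) x hx fun j hj =>
        x.support.le_max' j hj
  intro i
  induction i using WellFoundedLT.induction with
  | ind i ih =>
  intro x hxP hxi
  obtain ⟨y, ⟨hyN, hyi⟩, hyx⟩ := hlead i ⟨x, ⟨hxP, hxi⟩, rfl⟩
  have hz : ∀ j ∈ (x - y).support, j < i := fun j hj =>
    lt_of_le_of_ne (Submodule.sub_mem _ hxi hyi hj) fun hji =>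
      Finsupp.mem_support_iff.mp hj (by simpa [hji, sub_eq_zero] using hyx.symm)
  rw [← sub_add_cancel x y]
  refine N.add_mem ?_ hyN
  rcases eq_or_ne (x - y) 0 with h0 | h0
  · exact h0 ▸ N.zero_mem
  · have hne := Finsupp.support_nonempty_iff.mpr h0
    exact ih _ (hz _ ((x - y).support.max'_mem hne)) _ (P.sub_mem hxP (hNP hyN))
      fun j hj => (x - y).support.le_max' j hj

theorem free_submodule_finsupp [IsDomain R] [IsPrincipalIdealRing R] (P : Submodule R (ι →₀ R)) :
    Module.Free R P := by
  obtain ⟨_, _⟩ := exists_wellFoundedLT ι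
  have hgen : ∀ i, ∃ p ∈ P ⊓ Finsupp.supported R R (Set.Iic i),
      p i = Submodule.IsPrincipal.generator (leadingIdeal P i) := fun i =>
    Submodule.IsPrincipal.generator_mem (leadingIdeal P i)
  choose p hp hpi using hgen
  let I : Set ι := {i | leadingIdeal P i ≠ ⊥}
  let v : I → ι →₀ R := fun i => p i
  have hv : LinearIndependent R v := linearIndependent_of_support_le Subtype.val_injective
    (fun i => (hp i).2) fun i h0 => i.2 <|
      (Submodule.IsPrincipal.eq_bot_iff_generator_eq_zero _).mpr ((hpi i).symm.trans h0)
  have hspan : Submodule.span R (Set.range v) = P := by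
    refine eq_of_leadingIdeal_le (Submodule.span_le.mpr ?_) fun i => ?_
    · rintro _ ⟨i, rfl⟩
      exact (hp i).1
    · by_cases hi : leadingIdeal P i = ⊥
      · exact hi ▸ bot_le
      · rw [← Ideal.span_singleton_generator (leadingIdeal P i), Ideal.span_singleton_le_iff_mem]
        exact ⟨p i, ⟨Submodule.subset_span ⟨⟨i, hi⟩, rfl⟩, (hp i).2⟩, hpi i⟩
  exact hspan ▸ Module.Free.of_basis (Module.Basis.span hv)

theorem free_submodule_of_free {F : Type*} [IsDomain R] [IsPrincipalIdealRing R] [AddCommGroup F]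
    [Module R F] [Module.Free R F] (P : Submodule R F) : Module.Free R P := by
  let e := (Module.Free.chooseBasis R F).repr
  have := free_submodule_finsupp (P.map e.toLinearMap)
  exact Module.Free.of_equiv (e.submoduleMap P).symm

end FreeSubmodules

open scoped TensorProduct in
theorem exists_extend_of_projective_span_range {Z R A Q F : Type*} [CommRing Z] (S : Submonoid Z)
    [CommRing R] [Algebra Z R] [IsLocalization S R] [AddCommGroup A] [Module Z A]
    [AddCommGroup Q] [Module Z Q] [Module R Q] [IsScalarTower Z R Q]
    [AddCommGroup F] [Module Z F] [Module R F] [IsScalarTower Z R F]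
    (G : A →ₗ[Z] Q) (hG : Module.Projective R (Submodule.span R (Set.range G)))
    (φ : LinearMap.ker G →ₗ[Z] F) :
    ∃ ψ : A →ₗ[Z] F, ∀ x : LinearMap.ker G, ψ x = φ x := by
  let j : A →ₗ[Z] R ⊗[Z] A := TensorProduct.mk Z R A 1
  have : IsLocalizedModule S j := IsLocalization.tensorProduct_isLocalizedModule S R
  have : IsLocalizedModule S (LinearMap.id : Q →ₗ[Z] Q) := isLocalizedModule_id S Q R
  have hF : IsLocalizedModule S (LinearMap.id : F →ₗ[Z] F) := isLocalizedModule_id S F R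
  let g : R ⊗[Z] A →ₗ[Z] Q := IsLocalizedModule.map S j LinearMap.id G
  let gR : R ⊗[Z] A →ₗ[R] Q := g.extendScalarsOfIsLocalization S R
  have hgj : ∀ a, g (j a) = G a := IsLocalizedModule.map_apply S j LinearMap.id G
  have hrange : LinearMap.range gR = Submodule.span R (Set.range G) := by
    rw [← LinearMap.localized'_range_eq_range_localizedMap R S j LinearMap.id G,
      Submodule.localized'_eq_span, LinearMap.id_coe, Set.image_id, LinearMap.coe_range]
  have : Module.Projective R (LinearMap.range gR) := by rwa [hrange]
  -- The localization of `G` splits over its image; `ρ` is the resulting projection to its kernel.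
  obtain ⟨s, hs⟩ := Module.projective_lifting_property gR.rangeRestrict LinearMap.id
    gR.surjective_rangeRestrict
  have hs' : ∀ y, gR (s y) = y := fun y => congrArg Subtype.val (LinearMap.congr_fun hs y)
  let ρ : R ⊗[Z] A →ₗ[Z] LinearMap.ker g :=
    LinearMap.codRestrict _ ((LinearMap.id - s ∘ₗ gR.rangeRestrict).restrictScalars Z) fun t => by
      change gR (t - s (gR.rangeRestrict t)) = 0
      rw [map_sub, hs', sub_eq_zero]
      rfl
  let k := LinearMap.toKerIsLocalized S j (LinearMap.id : Q →ₗ[Z] Q) G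
  have : IsLocalizedModule S k := LinearMap.toKerLocalized_isLocalizedModule R S j LinearMap.id G
  refine ⟨IsLocalizedModule.lift S k φ hF.map_units ∘ₗ ρ ∘ₗ j, fun x => ?_⟩
  have hx : ρ (j x) = k x := by
    have h0 : gR.rangeRestrict (j x) = 0 := Subtype.ext ((hgj x).trans x.2)
    ext1
    change j x - s (gR.rangeRestrict (j x)) = j x
    rw [h0, map_zero, sub_zero]
  change IsLocalizedModule.lift S k φ hF.map_units (ρ (j x)) = φ x
  rw [hx, IsLocalizedModule.lift_apply]

theorem exists_addMonoidHom_extend_of_ker {R A Q F : Type*} (S : Submonoid ℤ) [CommRing R]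
    [Algebra ℤ R] [IsDomain R] [IsPrincipalIdealRing R] [IsLocalization S R] [AddCommGroup A]
    [AddCommGroup Q] [Module R Q] [Module.Free R Q] [AddCommGroup F] [Module R F] (G : A →+ Q)
    (φ : G.ker →+ F) : ∃ ψ : A →+ F, ∀ x : G.ker, ψ x = φ x := by
  obtain rfl : ‹Algebra ℤ R› = Ring.toIntAlgebra R := Subsingleton.elim _ _
  have : Module.Free R (Submodule.span R (Set.range G.toIntLinearMap)) := free_submodule_of_free _
  obtain ⟨ψ, hψ⟩ := exists_extend_of_projective_span_range (R := R) S G.toIntLinearMap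
    inferInstance φ.toIntLinearMap
  exact ⟨ψ.toAddMonoidHom, hψ⟩

section LocalizationAway

theorem isPrincipalIdealRing_of_isLocalization {Z : Type*} [CommRing Z] [IsPrincipalIdealRing Z]
    (S : Submonoid Z) (R : Type*) [CommRing R] [Algebra Z R] [IsLocalization S R] :
    IsPrincipalIdealRing R where
  principal I := by
    obtain ⟨a, ha⟩ := IsPrincipalIdealRing.principal (I.under Z)
    rw [← IsLocalization.map_under S R I, ha]
    exact ⟨_, by rw [Ideal.submodule_span_eq, Ideal.map_span, Set.image_singleton]⟩

theorem exists_away {m : ℕ} (hm : m ≠ 0) :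
    ∃ (R : Type) (_ : CommRing R) (_ : Algebra ℤ R) (_ : IsLocalization.Away (m : ℤ) R)
      (_ : IsDomain R) (_ : IsPrincipalIdealRing R) (_ : CharZero R), IsUnit (m : R) := by
  have hS : Submonoid.powers (m : ℤ) ≤ nonZeroDivisors ℤ :=
    powers_le_nonZeroDivisors_of_noZeroDivisors (Nat.cast_ne_zero.mpr hm)
  have hinj : Function.Injective (algebraMap ℤ (Localization.Away (m : ℤ))) :=
    IsLocalization.injective _ hS
  refine ⟨Localization.Away (m : ℤ), inferInstance, inferInstance, inferInstance,
    IsLocalization.isDomain_localization hS,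
    isPrincipalIdealRing_of_isLocalization (.powers (m : ℤ)) _, ⟨fun a b hab => ?_⟩, ?_⟩
  · exact Nat.cast_injective (R := ℤ) (hinj (by simpa using hab))
  · simpa using IsLocalization.Away.algebraMap_isUnit (S := Localization.Away (m : ℤ)) (m : ℤ)

theorem exists_injective_away_of_isUnit {m : ℕ} {R S : Type*} [CommRing R] [Algebra ℤ R]
    [IsLocalization.Away (m : ℤ) R] [CommRing S] [CharZero S] (hm : IsUnit (m : S)) :
    ∃ c : R →+* S, Function.Injective c := by
  have hunit : IsUnit (Int.castRingHom S m) := by simpa using hm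
  have hm0 : (m : ℤ) ≠ 0 := by
    intro h0
    simp [h0] at hunit
  refine ⟨IsLocalization.Away.lift (m : ℤ) hunit, ?_⟩
  rw [IsLocalization.Away.lift, IsLocalization.lift_injective_iff]
  have hinj : Function.Injective (algebraMap ℤ R) :=
    IsLocalization.injective R (powers_le_nonZeroDivisors_of_noZeroDivisors hm0)
  exact fun x y => hinj.eq_iff.trans (Int.cast_injective (α := S)).eq_iff.symm

end LocalizationAway

section BoundedByCobounded

/-- An abelian group is bounded-by-cobounded if it is an extension of a cobounded group by a
bounded one. Unlike direct products, such extensions are evidently inherited by subgroups. -/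
def IsBoundedByCobounded (A : Type u) [AddCommGroup A] : Prop :=
  ∃ B : AddSubgroup A, IsBoundedAddGroup B ∧ IsCoboundedAddGroup (A ⧸ B)

theorem ker_subtypeDomain_comp {A ι M : Type*} [AddCommGroup A] [AddCommGroup M]
    (f : A →+ (ι →₀ M)) :
    ((Finsupp.subtypeDomainAddMonoidHom (p := (· ∈ ⋃ x, ((f x).support : Set ι)))).comp f).ker =
      f.ker := by
  ext x
  refine (Finsupp.subtypeDomain_eq_zero_iff fun i hi => ?_)
  exact Set.mem_iUnion_of_mem x hi

theorem isCoboundedAddGroup_of_injective {A : Type u} {R F : Type*} [AddCommGroup A] [CommRing R]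
    [Algebra ℤ R] [AddCommGroup F] [Module R F] [Module.Free R F] {m : ℕ} (hm : m ≠ 0)
    [IsLocalization.Away (m : ℤ) R] (f : A →+ F) (hf : Function.Injective f) :
    IsCoboundedAddGroup A := by
  let e := (Module.Free.chooseBasis R F).repr
  let c : R ≃+* Localization.Away (m : ℤ) :=
    (IsLocalization.algEquiv (.powers (m : ℤ)) R (Localization.Away (m : ℤ))).toRingEquiv
  let f' := ((Finsupp.mapRange.addEquiv c.toAddEquiv).toAddMonoidHom.comp e.toAddMonoidHom).comp f
  have hf' : Function.Injective f' :=
    (Finsupp.mapRange.addEquiv c.toAddEquiv).injective.comp (e.injective.comp hf)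
  let s := ⋃ x, ((f' x).support : Set (Module.Free.ChooseBasisIndex R F))
  have : Small.{u} s := small_iUnion _
  refine ⟨m, Nat.pos_of_ne_zero hm, Shrink.{u} s,
    (Finsupp.domCongr (equivShrink s)).toAddMonoidHom.comp
      (Finsupp.subtypeDomainAddMonoidHom.comp f'),
    (Finsupp.domCongr (equivShrink s)).injective.comp ?_⟩
  rw [← AddMonoidHom.ker_eq_bot_iff, ker_subtypeDomain_comp, AddMonoidHom.ker_eq_bot_iff]
  exact hf'

theorem IsCoboundedAddGroup.exists_injective {A : Type u} [AddCommGroup A]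
    (h : IsCoboundedAddGroup A) :
    ∃ m : ℕ, m ≠ 0 ∧ ∃ ι : Type u, ∀ (R : Type) [CommRing R] [CharZero R],
      IsUnit (m : R) → ∃ f : A →+ (ι →₀ R), Function.Injective f := by
  obtain ⟨m, hm, ι, f, hf⟩ := h
  refine ⟨m, hm.ne', ι, fun R _ _ hmR => ?_⟩
  obtain ⟨c, hc⟩ := exists_injective_away_of_isUnit (R := Localization.Away (m : ℤ)) hmR
  exact ⟨(Finsupp.mapRange.addMonoidHom c.toAddMonoidHom).comp f,
    (Finsupp.mapRange_injective c (map_zero c) hc).comp hf⟩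

namespace IsBoundedByCobounded

theorem of_hom {A : Type u} {R F : Type*} [AddCommGroup A] [CommRing R] [Algebra ℤ R]
    [AddCommGroup F] [Module R F] [Module.Free R F] {n m : ℕ} (hn : n ≠ 0) (hm : m ≠ 0)
    [IsLocalization.Away (m : ℤ) R] (f : A →+ F) (hf : ∀ x, f x = 0 → n • x = 0) :
    IsBoundedByCobounded A :=
  ⟨f.ker, ⟨n, Nat.pos_of_ne_zero hn, fun b => Subtype.ext (hf b b.2)⟩,
    isCoboundedAddGroup_of_injective (R := R) hm (QuotientAddGroup.kerLift f)
      (QuotientAddGroup.kerLift_injective f)⟩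

theorem of_hom_int {A F : Type*} [AddCommGroup A] [AddCommGroup F] [Module.Free ℤ F] {n : ℕ}
    (hn : n ≠ 0) (f : A →+ F) (hf : ∀ x, f x = 0 → n • x = 0) : IsBoundedByCobounded A :=
  have : IsLocalization.Away ((1 : ℕ) : ℤ) ℤ :=
    IsLocalization.away_of_isUnit_of_bijective ℤ (by simp) Function.bijective_id
  of_hom (R := ℤ) hn one_ne_zero f hf

theorem exists_hom {A : Type u} [AddCommGroup A] (h : IsBoundedByCobounded A) :
    ∃ n m : ℕ, n ≠ 0 ∧ m ≠ 0 ∧ ∃ ι : Type u, ∀ (R : Type) [CommRing R] [CharZero R],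
      IsUnit (m : R) → ∃ f : A →+ (ι →₀ R), ∀ x, f x = 0 → n • x = 0 := by
  obtain ⟨B, ⟨n, hn, hB⟩, hcob⟩ := h
  obtain ⟨m, hm, ι, hf⟩ := hcob.exists_injective
  refine ⟨n, m, hn.ne', hm, ι, fun R _ _ hmR => ?_⟩
  obtain ⟨f, hf⟩ := hf R hmR
  refine ⟨f.comp (QuotientAddGroup.mk' B), fun x hx => ?_⟩
  have hxB : x ∈ B := (QuotientAddGroup.eq_zero_iff x).mp ((map_eq_zero_iff f hf).mp hx)
  exact congrArg Subtype.val (hB ⟨x, hxB⟩)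

theorem of_nsmul_eq_zero {A : Type*} [AddCommGroup A] {n : ℕ} (hn : n ≠ 0)
    (h : ∀ x : A, n • x = 0) : IsBoundedByCobounded A :=
  of_hom_int hn (0 : A →+ ℤ) fun x _ => h x

theorem of_finite {A : Type*} [AddCommGroup A] [Finite A] : IsBoundedByCobounded A :=
  of_nsmul_eq_zero Nat.card_pos.ne' fun _ => card_nsmul_eq_zero' (G := A)

theorem of_injective {A A' : Type*} [AddCommGroup A] [AddCommGroup A']
    (h : IsBoundedByCobounded A') (g : A →+ A') (hg : Function.Injective g) :
    IsBoundedByCobounded A := by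
  obtain ⟨n, m, hn, hm, ι, hf⟩ := h.exists_hom
  obtain ⟨R, _, _, _, _, _, _, hmR⟩ := exists_away hm
  obtain ⟨f, hf⟩ := hf R hmR
  exact of_hom (R := R) hn hm (f.comp g) fun x hx =>
    hg <| by rw [map_nsmul, hf _ hx, map_zero]

theorem of_hom_ker {A R Q F : Type*} [AddCommGroup A] [CommRing R] [IsDomain R]
    [IsPrincipalIdealRing R] [Algebra ℤ R] [AddCommGroup Q] [Module R Q] [Module.Free R Q]
    [AddCommGroup F] [Module R F] [Module.Free R F] {n m : ℕ} (hn : n ≠ 0) (hm : m ≠ 0)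
    [IsLocalization.Away (m : ℤ) R] (G : A →+ Q) (φ : G.ker →+ F)
    (hφ : ∀ x, φ x = 0 → n • x = 0) : IsBoundedByCobounded A := by
  obtain ⟨ψ, hψ⟩ := exists_addMonoidHom_extend_of_ker (R := R) (.powers (m : ℤ)) G φ
  refine of_hom (R := R) hn hm (G.prod ψ) fun x hx => ?_
  obtain ⟨hGx, hψx⟩ := Prod.mk_eq_zero.mp hx
  exact congrArg Subtype.val (hφ ⟨x, hGx⟩ ((hψ ⟨x, hGx⟩).symm.trans hψx))

theorem of_ker {A A' : Type*} [AddCommGroup A] [AddCommGroup A'] (g : A →+ A')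
    (h : IsBoundedByCobounded A') (hker : IsBoundedByCobounded g.ker) :
    IsBoundedByCobounded A := by
  obtain ⟨n, m, hn, hm, ι, hf⟩ := h.exists_hom
  obtain ⟨n₁, m₁, hn₁, hm₁, ι₁, hf₁⟩ := hker.exists_hom
  have hM : m * m₁ ≠ 0 := mul_ne_zero hm hm₁
  obtain ⟨R, _, _, _, _, _, _, hMR⟩ := exists_away hM
  rw [Nat.cast_mul, IsUnit.mul_iff] at hMR
  obtain ⟨f, hf⟩ := hf R hMR.1
  obtain ⟨f₁, hf₁⟩ := hf₁ R hMR.2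
  let mulN : (f.comp g).ker →+ g.ker :=
    ((nsmulAddMonoidHom n).comp (f.comp g).ker.subtype).codRestrict g.ker
      fun x => (map_nsmul g n (x : A)).trans (hf _ x.2)
  refine of_hom_ker (R := R) (mul_ne_zero hn₁ hn) hM (f.comp g) (f₁.comp mulN) fun x hx => ?_
  rw [mul_smul]
  exact Subtype.ext (congrArg (fun y : g.ker => (y : A)) (hf₁ (mulN x) hx))

theorem pi {ι : Type*} [Finite ι] {B : ι → Type*} [∀ i, AddCommGroup (B i)]
    (h : ∀ i, IsBoundedByCobounded (B i)) : IsBoundedByCobounded (∀ i, B i) := by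
  have := Fintype.ofFinite ι
  choose n m hn hm κ hf using fun i => (h i).exists_hom
  have hM : ∏ i, m i ≠ 0 := Finset.prod_ne_zero_iff.mpr fun i _ => hm i
  obtain ⟨R, _, _, _, _, _, _, hMR⟩ := exists_away hM
  choose f hf using fun i => hf i R <|
    isUnit_of_dvd_unit (Nat.cast_dvd_cast (Finset.dvd_prod_of_mem m (Finset.mem_univ i))) hMR
  refine of_hom (R := R) (n := ∏ i, n i) (Finset.prod_ne_zero_iff.mpr fun i _ => hn i) hM
    (AddMonoidHom.mk' (fun (x : ∀ i, B i) i => f i (x i)) fun x y => funext fun i =>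
      map_add (f i) (x i) (y i)) fun x hx => funext fun i => ?_
  obtain ⟨k, hk⟩ := Finset.dvd_prod_of_mem n (Finset.mem_univ i)
  rw [Pi.smul_apply, hk, mul_comm, mul_smul, hf i _ (congrFun hx i), smul_zero, Pi.zero_apply]

end IsBoundedByCobounded

end BoundedByCobounded

section Splitting

theorem isCompl_map_subtype {R H : Type*} [CommRing R] [AddCommGroup H] [Module R H]
    {B D : Submodule R H} (hBD : B ⊔ D = ⊤) {E : Submodule R D}
    (hE : IsCompl (B.comap D.subtype) E) :
    IsCompl B (E.map D.subtype) := by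
  constructor
  · rw [Submodule.disjoint_def]
    rintro _ hx ⟨y, hy, rfl⟩
    rw [Submodule.disjoint_def.mp hE.disjoint y hx hy, map_zero]
  · have hD : B ⊓ D ⊔ E.map D.subtype = D := by
      rw [inf_comm, ← Submodule.map_comap_subtype, ← Submodule.map_sup, hE.sup_eq_top,
        Submodule.map_subtype_top]
    rw [codisjoint_iff, ← sup_inf_self (a := B) (b := D), sup_assoc, hD, hBD]

variable {R : Type*} [CommRing R] [IsDomain R] [IsPrincipalIdealRing R]

theorem exists_isCompl_of_isTorsionBy_prime {M : Type*} [AddCommGroup M] [Module R M] {p : R}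
    (hp : Prime p) (hM : Module.IsTorsionBy R M p) (N : Submodule R M) :
    ∃ W : Submodule R M, IsCompl N W := by
  have : (Ideal.span {p}).IsMaximal :=
    PrincipalIdealRing.isMaximal_of_irreducible hp.irreducible
  let := Ideal.Quotient.field (Ideal.span {p})
  have hset : Module.IsTorsionBySet R M (Ideal.span {p}) :=
    (Module.isTorsionBySet_span_singleton_iff p).mpr hM
  let := hset.module
  have : IsSemisimpleModule R M := hset.isSemisimpleModule_iff.mp inferInstance
  exact exists_isCompl N

theorem exists_sup_eq_top_inf_le_smul_of_prime {H : Type*} [AddCommGroup H] [Module R H] {p : R}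
    (hp : Prime p) (B : Submodule R H) (hB : ∀ x, p • x ∈ B → x ∈ B) :
    ∃ D : Submodule R H, B ⊔ D = ⊤ ∧ ∀ x ∈ B ⊓ D, ∃ y ∈ B, p • y = x := by
  let P : Submodule R H := LinearMap.range (LinearMap.lsmul R H p)
  have hP : Module.IsTorsionBy R (H ⧸ P) p :=
    (Module.isTorsionBy_quotient_iff P p).mpr fun x => ⟨x, rfl⟩
  obtain ⟨W, hW⟩ := exists_isCompl_of_isTorsionBy_prime hp hP (B.map P.mkQ)
  refine ⟨W.comap P.mkQ, ?_, ?_⟩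
  · rw [eq_top_iff]
    intro x _
    obtain ⟨_, ⟨b, hb, rfl⟩, w, hw, hbw⟩ :=
      Submodule.mem_sup.mp (hW.sup_eq_top ▸ Submodule.mem_top : P.mkQ x ∈ B.map P.mkQ ⊔ W)
    refine Submodule.mem_sup.mpr ⟨b, hb, x - b, ?_, add_sub_cancel b x⟩
    rwa [Submodule.mem_comap, map_sub, ← hbw, add_sub_cancel_left]
  · rintro x ⟨hxB, hxW⟩
    have hx : P.mkQ x = 0 := Submodule.disjoint_def.mp hW.disjoint _ ⟨x, hxB, rfl⟩ hxW
    obtain ⟨y, rfl⟩ := (Submodule.Quotient.mk_eq_zero P).mp hx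
    exact ⟨y, hB y hxB, rfl⟩

theorem exists_isCompl_of_bounded {H : Type*} [AddCommGroup H] [Module R H] (B : Submodule R H)
    {a : R} (ha : a ≠ 0) (hB : ∀ x ∈ B, a • x = 0) (h : ∀ r : R, r ≠ 0 → ∀ x, r • x ∈ B → x ∈ B) :
    ∃ D : Submodule R H, IsCompl B D := by
  induction a using UniqueFactorizationMonoid.induction_on_prime generalizing H with
  | h₁ => exact absurd rfl ha
  | h₂ a hunit =>
    have : B = ⊥ := (Submodule.eq_bot_iff B).mpr fun x hx => hunit.smul_eq_zero.mp (hB x hx)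
    exact ⟨⊤, this ▸ isCompl_bot_top⟩
  | h₃ a p ha0 hp ih =>
    obtain ⟨D, hBD, hBD'⟩ := exists_sup_eq_top_inf_le_smul_of_prime hp B (h p hp.ne_zero)
    have hkill : ∀ x ∈ B.comap D.subtype, a • x = 0 := fun x hx => by
      obtain ⟨y, hy, hyx⟩ := hBD' x ⟨hx, x.2⟩
      ext1
      rw [Submodule.coe_smul, ← hyx, smul_smul, mul_comm, hB y hy, Submodule.coe_zero]
    obtain ⟨E, hE⟩ := ih (B.comap D.subtype) ha0 hkill fun r hr x hx => h r hr x hx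
    exact ⟨E.map D.subtype, isCompl_map_subtype hBD hE⟩

theorem IsCoboundedAddGroup.isAddTorsionFree {A : Type u} [AddCommGroup A]
    (h : IsCoboundedAddGroup A) : IsAddTorsionFree A := by
  obtain ⟨m, hm, ι, hf⟩ := h.exists_injective
  obtain ⟨R, _, _, _, _, _, _, hmR⟩ := exists_away hm
  obtain ⟨f, hf⟩ := hf R hmR
  exact hf.isAddTorsionFree f

theorem IsBoundedByCobounded.isBoundedTimesCobounded {H : Type u} [AddCommGroup H]
    (h : IsBoundedByCobounded H) : IsBoundedTimesCobounded H := by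
  obtain ⟨B, hB, hcob⟩ := h
  have ⟨n, hn, hnB⟩ := hB
  have hpure : ∀ r : ℤ, r ≠ 0 → ∀ x, r • x ∈ B → x ∈ B := fun r hr x hx => by
    have := hcob.isAddTorsionFree
    rw [← QuotientAddGroup.eq_zero_iff] at hx ⊢
    exact (smul_eq_zero.mp hx).resolve_left hr
  obtain ⟨D, hD⟩ := exists_isCompl_of_bounded (AddSubgroup.toIntSubmodule B)
    (Nat.cast_ne_zero.mpr hn.ne' : (n : ℤ) ≠ 0)
    (fun x hx => (natCast_zsmul x n).trans (congrArg Subtype.val (hnB ⟨x, hx⟩))) hpure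
  let e : H ≃ₗ[ℤ] B × H ⧸ B := (Submodule.prodEquivOfIsCompl _ D hD).symm.trans
    ((LinearEquiv.refl ℤ B).prodCongr (Submodule.quotientEquivOfIsCompl _ D hD).symm)
  exact ⟨B, H ⧸ B, inferInstance, inferInstance, hB, hcob, ⟨e.toAddEquiv⟩⟩

end Splitting

section BoundedEmbedding

theorem exists_injective_zmod_addCircle {n : ℕ} (hn : n ≠ 0) :
    ∃ e : ZMod n →+ AddCircle (1 : ℚ), Function.Injective e ∧ ∀ u, n • u = 0 → u ∈ e.range := by
  have hn' := Nat.pos_of_ne_zero hn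
  let u₁ : AddCircle (1 : ℚ) := ((1 / n : ℚ) : AddCircle (1 : ℚ))
  have hu₁ : addOrderOf u₁ = n := AddCircle.addOrderOf_period_div hn'
  have hnu₁ : zmultiplesHom _ u₁ n = 0 := by
    rw [zmultiplesHom_apply, ← addOrderOf_dvd_iff_zsmul_eq_zero, hu₁]
  refine ⟨ZMod.lift n ⟨zmultiplesHom _ u₁, hnu₁⟩, ?_, fun u hu => ?_⟩
  · refine (ZMod.lift_injective _).mpr fun k hk => ?_
    rwa [ZMod.intCast_zmod_eq_zero_iff_dvd, ← hu₁, addOrderOf_dvd_iff_zsmul_eq_zero]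
  · obtain ⟨k, -, rfl⟩ := (AddCircle.nsmul_eq_zero_iff hn').mp hu
    refine ⟨(k : ℤ), ?_⟩
    rw [ZMod.lift_coe]
    change (k : ℤ) • u₁ = _
    rw [natCast_zsmul, ← AddCircle.coe_nsmul, nsmul_eq_mul, mul_one_div, mul_one]

theorem exists_addMonoidHom_zmod_ne_zero {A : Type*} [AddCommGroup A] {n : ℕ} (hn : n ≠ 0)
    (h : ∀ x : A, n • x = 0) {a : A} (ha : a ≠ 0) : ∃ φ : A →+ ZMod n, φ a ≠ 0 := by
  obtain ⟨c, hc⟩ := CharacterModule.exists_character_apply_ne_zero_of_ne_zero ha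
  obtain ⟨e, he, hrange⟩ := exists_injective_zmod_addCircle hn
  let c' : A →+ AddCircle (1 : ℚ) := c
  have hr : ∀ x, c' x ∈ e.range := fun x =>
    hrange _ (by rw [← map_nsmul, h, map_zero])
  let E := AddMonoidHom.ofInjective he
  refine ⟨E.symm.toAddMonoidHom.comp (c'.codRestrict e.range hr), fun h0 => hc ?_⟩
  exact congrArg Subtype.val ((map_eq_zero_iff E.symm E.symm.injective).mp h0)

theorem exists_injective_finsupp_of_filtration {A M : Type*} [AddCommGroup A] [AddCommGroup M]
    (B : ℕ → AddSubgroup A) [∀ k, Finite (B k)] (hmono : Monotone B) (hbot : B 0 = ⊥)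
    (hex : ∀ x, ∃ k, x ∈ B k)
    (hsep : ∀ k, ∀ x ∉ B k, ∃ φ : A →+ M, B k ≤ φ.ker ∧ φ x ≠ 0) :
    ∃ f : A →+ (A →₀ M), Function.Injective f := by
  -- Let `φ x` detect `x` and kill each `B k` not containing `x`. Then `φ x y ≠ 0` with `y ∈ B k`
  -- forces `x ∈ B k`, which leaves finitely many `x` for each `y`.
  have hφ : ∀ x : A, ∃ φ : A →+ M, (∀ k, x ∉ B k → B k ≤ φ.ker) ∧ (x ≠ 0 → φ x ≠ 0) := by
    intro x
    by_cases hx : x = 0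
    · exact ⟨0, fun k _ y _ => rfl, fun h => absurd hx h⟩
    have hx0 : x ∉ B 0 := by rwa [hbot, AddSubgroup.mem_bot]
    obtain ⟨k, hxk, hxk'⟩ := Nat.exists_not_and_succ_of_not_zero_of_exists hx0 (hex x)
    obtain ⟨φ, hφ, hφx⟩ := hsep k x hxk
    refine ⟨φ, fun l hxl => (hmono ?_).trans hφ, fun _ => hφx⟩
    by_contra! hkl
    exact hxl (hmono hkl hxk')
  choose φ hφ hφ' using hφ
  have hfin : ∀ y, (Function.support fun x => φ x y).Finite := fun y => by
    obtain ⟨k, hk⟩ := hex y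
    refine (Set.toFinite (B k : Set A)).subset fun x hx => ?_
    by_contra hxk
    exact hx (hφ x k hxk hk)
  let f : A →+ (A →₀ M) := AddMonoidHom.mk' (fun y => Finsupp.ofSupportFinite _ (hfin y))
    fun y z => Finsupp.ext fun x => map_add (φ x) y z
  refine ⟨f, (injective_iff_map_eq_zero f).mpr fun x hx => ?_⟩
  by_contra hx0
  exact hφ' x hx0 (DFunLike.congr_fun hx x)

theorem exists_injective_finsupp_zmod {A : Type*} [AddCommGroup A] [Countable A] {n : ℕ}
    (hn : n ≠ 0) (h : ∀ x : A, n • x = 0) :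
    ∃ f : A →+ (A →₀ ZMod n), Function.Injective f := by
  obtain ⟨b, hb⟩ := exists_surjective_nat A
  let B : ℕ → AddSubgroup A := fun k => AddSubgroup.closure (b '' Set.Iio k)
  have hfin : ∀ k, Finite (B k) := fun k => by
    have : AddGroup.FG (B k) := AddGroup.closure_finite_fg _
    exact AddCommGroup.finite_of_fg_isAddTorsion _ fun x =>
      isOfFinAddOrder_iff_nsmul_eq_zero.mpr ⟨n, Nat.pos_of_ne_zero hn, Subtype.ext (h x)⟩
  refine exists_injective_finsupp_of_filtration B
    (fun k l hkl => AddSubgroup.closure_mono (Set.image_mono (Set.Iio_subset_Iio hkl)))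
    (by simp [B]) (fun x => ?_) fun k x hx => ?_
  · obtain ⟨k, rfl⟩ := hb x
    exact ⟨k + 1, AddSubgroup.subset_closure ⟨k, Nat.lt_succ_self k, rfl⟩⟩
  · have hquot : ∀ y : A ⧸ B k, n • y = 0 := fun y => by
      obtain ⟨y, rfl⟩ := QuotientAddGroup.mk_surjective y
      rw [← QuotientAddGroup.mk_nsmul, h, QuotientAddGroup.mk_zero]
    obtain ⟨φ, hφ⟩ := exists_addMonoidHom_zmod_ne_zero hn hquot
      (mt (QuotientAddGroup.eq_zero_iff x).mp hx)
    refine ⟨φ.comp (QuotientAddGroup.mk' (B k)), fun y hy => ?_, hφ⟩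
    exact (congrArg φ ((QuotientAddGroup.eq_zero_iff y).mpr hy)).trans (map_zero φ)

end BoundedEmbedding

section Linear

open Polynomial

theorem exists_injective_polynomial_of_finsupp {A ι R : Type*} [AddCommGroup A] [Countable A]
    [CommRing R] (f : A →+ (ι →₀ R)) (hf : Function.Injective f) :
    ∃ g : A →+ R[X], Function.Injective g := by
  let s := ⋃ x, ((f x).support : Set ι)
  have : Countable s := (Set.countable_iUnion fun x => (f x).support.countable_toSet).to_subtype
  obtain ⟨c, hc⟩ := exists_injective_nat s
  refine ⟨((basisMonomials R).repr.symm.toAddMonoidHom.comp (Finsupp.mapDomain.addMonoidHom c)).comp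
    (Finsupp.subtypeDomainAddMonoidHom.comp f),
    ((basisMonomials R).repr.symm.injective.comp (Finsupp.mapDomain_injective hc)).comp ?_⟩
  rw [← AddMonoidHom.ker_eq_bot_iff, ker_subtypeDomain_comp, AddMonoidHom.ker_eq_bot_iff]
  exact hf

theorem IsArithmeticallyLinear.of_addMonoidHom {H : Type u} [AddCommGroup H] {R : Type}
    [CommRing R] [Algebra ℤ R] [Algebra.FiniteType ℤ R] (f : H →+ R) (hf : Function.Injective f) :
    IsArithmeticallyLinear.{u, v} (Multiplicative H) := by
  obtain rfl : ‹Algebra ℤ R› = Ring.toIntAlgebra R := Subsingleton.elim _ _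
  let e : R ≃ₐ[ℤ] ULift.{v} R := ULift.algEquiv.symm
  let g : H →+ ULift.{v} R := e.toRingEquiv.toAddEquiv.toAddMonoidHom.comp f
  exact ⟨2, ULift.{v} R, inferInstance, Algebra.FiniteType.equiv ‹_› e,
    Matrix.GeneralLinearGroup.upperRightHom.toMonoidHom.comp (AddMonoidHom.toMultiplicative g),
    Matrix.GeneralLinearGroup.injective_upperRightHom.comp (e.injective.comp hf)⟩

theorem IsBoundedTimesCobounded.isArithmeticallyLinear {H : Type u} [AddCommGroup H] [Countable H]
    (h : IsBoundedTimesCobounded H) : IsArithmeticallyLinear.{u, v} (Multiplicative H) := by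
  obtain ⟨B, C, _, _, ⟨n, hn, hB⟩, hC, ⟨e⟩⟩ := h
  have : Countable (B × C) := e.surjective.countable
  have : Countable B := Prod.fst_surjective (β := C) |>.countable
  have : Countable C := Prod.snd_surjective (α := B) |>.countable
  obtain ⟨m, hm, ι, hf⟩ := hC.exists_injective
  obtain ⟨R, _, _, _, _, _, _, hmR⟩ := exists_away hm
  obtain ⟨f, hf⟩ := hf R hmR
  obtain ⟨g, hg⟩ := exists_injective_finsupp_zmod hn.ne' hB
  obtain ⟨p, hp⟩ := exists_injective_polynomial_of_finsupp g hg
  obtain ⟨q, hq⟩ := exists_injective_polynomial_of_finsupp f hf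
  have : Algebra.FiniteType ℤ (ZMod n) :=
    Algebra.FiniteType.of_surjective (Int.castRingHom (ZMod n)).toIntAlgHom ZMod.intCast_surjective
  have : Algebra.FiniteType ℤ R := IsLocalization.finiteType_of_monoid_fg (.powers (m : ℤ)) R
  exact .of_addMonoidHom ((p.prodMap q).comp e.toAddMonoidHom)
    ((Function.Injective.prodMap hp hq).comp e.injective)

end Linear

section GenericFreeness

theorem exists_finset_subset_forall_exists_le {α β : Type*} [PartialOrder β]
    [WellQuasiOrderedLE β] (f : α → β) (s : Set α) :
    ∃ t : Finset α, ↑t ⊆ s ∧ ∀ x ∈ s, ∃ y ∈ t, f y ≤ f x := by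
  classical
  have hfin : {u | Minimal (· ∈ f '' s) u}.Finite :=
    (setOfPred_minimal_antichain _).finite_of_partiallyWellOrderedOn
      (Set.isPWO_of_wellQuasiOrderedLE _)
  obtain ⟨t, hts, ht⟩ := Finset.subset_set_image_iff.mp <|
    (hfin.coe_toFinset).trans_subset fun u hu => hu.prop
  refine ⟨t, hts, fun x hx => ?_⟩
  obtain ⟨u, hux, hu⟩ :=
    exists_minimal_le_of_wellFoundedLT (· ∈ f '' s) (f x) (Set.mem_image_of_mem f hx)
  obtain ⟨y, hy, rfl⟩ := Finset.mem_image.mp (ht ▸ hfin.mem_toFinset.mpr hu)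
  exact ⟨y, hy, hux⟩

open MvPolynomial

variable {σ Z : Type*} [CommRing Z]

theorem degree_map_of_injective (m : MonomialOrder σ) {S : Type*} [CommRing S] {φ : Z →+* S}
    (hφ : Function.Injective φ) (f : MvPolynomial σ Z) : m.degree (map φ f) = m.degree f := by
  rw [MonomialOrder.degree, MonomialOrder.degree, support_map_of_injective f hφ]

theorem leadingCoeff_map_of_injective (m : MonomialOrder σ) {S : Type*} [CommRing S]
    {φ : Z →+* S} (hφ : Function.Injective φ) (f : MvPolynomial σ Z) :
    m.leadingCoeff (map φ f) = φ (m.leadingCoeff f) := by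
  rw [MonomialOrder.leadingCoeff, degree_map_of_injective m hφ, coeff_map,
    MonomialOrder.leadingCoeff]

theorem free_quotient_of_isUnit_leadingCoeff (m : MonomialOrder σ) {I : Ideal (MvPolynomial σ Z)}
    {B : Set (MvPolynomial σ Z)} (hBI : B ⊆ I) (hunit : ∀ b ∈ B, IsUnit (m.leadingCoeff b))
    (hdeg : ∀ f ∈ I, f ≠ 0 → ∃ b ∈ B, m.degree b ≤ m.degree f) :
    Module.Free Z (MvPolynomial σ Z ⧸ I) := by
  let s : Set (σ →₀ ℕ) := {u | ∀ b ∈ B, ¬ m.degree b ≤ u}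
  have hcompl : IsCompl (I.restrictScalars Z) (restrictSupport Z s) := by
    refine ⟨Submodule.disjoint_def.mpr fun f hfI hfs => ?_,
      codisjoint_iff_le_sup.mpr fun f _ => ?_⟩
    · by_contra hf
      obtain ⟨b, hb, hbf⟩ := hdeg f hfI hf
      exact (mem_restrictSupport_iff Z).mp hfs (m.degree_mem_support hf) b hb hbf
    · obtain ⟨g, r, rfl, -, hr⟩ := m.div_set hunit f
      refine add_mem (Submodule.mem_sup_left ?_) (Submodule.mem_sup_right hr)
      exact Submodule.span_le.mpr hBI (Finsupp.mem_span_iff_linearCombination _ _ _ |>.mpr ⟨g, rfl⟩)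
  have := Module.Free.of_basis (basisRestrictSupport Z s)
  exact Module.Free.of_equiv ((Submodule.quotientEquivOfIsCompl _ _ hcompl).symm ≪≫ₗ
    Submodule.Quotient.restrictScalarsEquiv Z I)

attribute [local instance] algebraMvPolynomial in
theorem exists_map_eq_smul_of_mem_map {I : Ideal (MvPolynomial σ Z)} (M : Submonoid Z) {S : Type*}
    [CommRing S] [Algebra Z S] [IsLocalization M S] {f : MvPolynomial σ S}
    (hf : f ∈ I.map (map (algebraMap Z S))) :
    ∃ g ∈ I, ∃ c ∈ M, map (algebraMap Z S) g = algebraMap Z S c • f := by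
  obtain ⟨⟨⟨g, hg⟩, ⟨_, c, hc, rfl⟩⟩, h⟩ :=
    (IsLocalization.mem_map_algebraMap_iff (M.map (C (σ := σ))) (MvPolynomial σ S)).mp hf
  refine ⟨g, hg, c, hc, ?_⟩
  rw [smul_eq_C_mul, mul_comm, ← map_C]
  exact h.symm

theorem exists_degree_eq_of_mem_map (m : MonomialOrder σ) {I : Ideal (MvPolynomial σ Z)}
    {M : Submonoid Z} (hM : M ≤ nonZeroDivisors Z) {S : Type*} [CommRing S] [Algebra Z S]
    [IsLocalization M S] {f : MvPolynomial σ S} (hf : f ∈ I.map (map (algebraMap Z S)))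
    (hf0 : f ≠ 0) : ∃ g ∈ I, g ≠ 0 ∧ m.degree g = m.degree f := by
  obtain ⟨g, hg, c, hc, hgf⟩ := exists_map_eq_smul_of_mem_map M hf
  have hcu : IsUnit (algebraMap Z S c) := IsLocalization.map_units S ⟨c, hc⟩
  refine ⟨g, hg, ?_, ?_⟩
  · rintro rfl
    rw [map_zero, eq_comm, hcu.smul_eq_zero] at hgf
    exact hf0 hgf
  · rw [← degree_map_of_injective m (IsLocalization.injective S hM), hgf,
      m.degree_smul_of_isRegular hcu.isRegular]

theorem exists_smul_mem_of_map_mem_map {I : Ideal (MvPolynomial σ Z)} {M : Submonoid Z}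
    (hM : M ≤ nonZeroDivisors Z) {S : Type*} [CommRing S] [Algebra Z S] [IsLocalization M S]
    {f : MvPolynomial σ Z} (hf : map (algebraMap Z S) f ∈ I.map (map (algebraMap Z S))) :
    ∃ c ∈ M, c • f ∈ I := by
  obtain ⟨g, hg, c, hc, hgf⟩ := exists_map_eq_smul_of_mem_map M hf
  have hgc : g = c • f := map_injective _ (IsLocalization.injective S hM) <| by
    rw [hgf, smul_eq_C_mul, smul_eq_C_mul, map_mul, map_C]
  exact ⟨c, hc, hgc ▸ hg⟩

theorem exists_free_quotient_map [IsDomain Z] [Finite σ] (I : Ideal (MvPolynomial σ Z)) :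
    ∃ r : Z, r ≠ 0 ∧ ∀ (M : Submonoid Z), M ≤ nonZeroDivisors Z → ∀ (S : Type*) [CommRing S]
      [Algebra Z S] [IsLocalization M S], IsUnit (algebraMap Z S r) →
      Module.Free S (MvPolynomial σ S ⧸ I.map (map (algebraMap Z S))) := by
  obtain ⟨_, -⟩ := exists_wellFoundedLT σ
  let m : MonomialOrder σ := .degLex
  obtain ⟨t, htI, ht⟩ := exists_finset_subset_forall_exists_le m.degree {f | f ∈ I ∧ f ≠ 0}
  refine ⟨∏ b ∈ t, m.leadingCoeff b, Finset.prod_ne_zero_iff.mpr fun b hb =>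
    m.leadingCoeff_ne_zero_iff.mpr (htI hb).2, fun M hM S _ _ _ hr => ?_⟩
  have hinj : Function.Injective (algebraMap Z S) := IsLocalization.injective S hM
  refine free_quotient_of_isUnit_leadingCoeff m (B := map (algebraMap Z S) '' t) ?_ ?_ ?_
  · rintro _ ⟨b, hb, rfl⟩
    exact Ideal.mem_map_of_mem _ (htI hb).1
  · rintro _ ⟨b, hb, rfl⟩
    rw [leadingCoeff_map_of_injective m hinj]
    exact isUnit_of_dvd_unit (map_dvd _ (Finset.dvd_prod_of_mem _ hb)) hr
  · intro f hf hf0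
    obtain ⟨g, hg, hg0, hgf⟩ := exists_degree_eq_of_mem_map m hM hf hf0
    obtain ⟨b, hb, hbg⟩ := ht g ⟨hg, hg0⟩
    exact ⟨_, ⟨b, hb, rfl⟩, by rwa [degree_map_of_injective m hinj, ← hgf]⟩

theorem exists_forall_pow_smul_eq_zero {R N : Type*} [CommRing R] [AddCommGroup N] [Module R N]
    [IsNoetherian R N] (a : R) : ∃ n : ℕ, ∀ (k : ℕ) (x : N), a ^ k • x = 0 → a ^ n • x = 0 := by
  obtain ⟨n, hn⟩ := Filter.eventually_atTop.mp
    (LinearMap.eventually_iSup_ker_pow_eq (algebraMap R (Module.End R N) a))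
  refine ⟨n, fun k x hx => ?_⟩
  simp only [← map_pow] at hn
  have hxn : x ∈ (algebraMap R (Module.End R N) (a ^ n)).ker :=
    hn n le_rfl ▸ Submodule.mem_iSup_of_mem k hx
  exact hxn

theorem IsBoundedByCobounded.quotient_mvPolynomial_int {σ : Type*} [Finite σ]
    (I : Ideal (MvPolynomial σ ℤ)) : IsBoundedByCobounded (MvPolynomial σ ℤ ⧸ I) := by
  obtain ⟨r, hr, hfree⟩ := exists_free_quotient_map I
  have hm : r.natAbs ≠ 0 := Int.natAbs_ne_zero.mpr hr
  obtain ⟨R, _, _, _, _, _, _, hmR⟩ := exists_away hm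
  have hM : Submonoid.powers (r.natAbs : ℤ) ≤ nonZeroDivisors ℤ :=
    powers_le_nonZeroDivisors_of_noZeroDivisors (Nat.cast_ne_zero.mpr hm)
  have := hfree _ hM R <| by
    refine isUnit_of_dvd_unit (map_dvd (algebraMap ℤ R) (Int.dvd_natAbs.mpr dvd_rfl)) ?_
    simpa using hmR
  obtain ⟨n, hn⟩ := exists_forall_pow_smul_eq_zero (R := MvPolynomial σ ℤ)
    (N := MvPolynomial σ ℤ ⧸ I) (r.natAbs : MvPolynomial σ ℤ)
  refine of_hom (R := R) (pow_ne_zero n hm) hm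
    (Ideal.quotientMap (I.map (map (algebraMap ℤ R))) _ Ideal.le_comap_map).toAddMonoidHom ?_
  intro x hx
  obtain ⟨f, rfl⟩ := Ideal.Quotient.mk_surjective x
  obtain ⟨_, ⟨k, rfl⟩, hk⟩ := exists_smul_mem_of_map_mem_map (S := R) hM
    (Ideal.Quotient.eq_zero_iff_mem.mp hx)
  have hkx := hn k (Ideal.Quotient.mk I f) <| Ideal.Quotient.eq_zero_iff_mem.mpr <| by
    simpa [smul_eq_C_mul] using hk
  change r.natAbs ^ n • Ideal.Quotient.mk I f = 0
  rwa [← Nat.cast_smul_eq_nsmul (MvPolynomial σ ℤ), Nat.cast_pow]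

theorem IsBoundedByCobounded.of_finiteType_int (A : Type*) [CommRing A] [Algebra.FiniteType ℤ A] :
    IsBoundedByCobounded A := by
  obtain ⟨n, f, hf⟩ := Algebra.FiniteType.iff_quotient_mvPolynomial''.mp
    (inferInstance : Algebra.FiniteType ℤ A)
  let e := Ideal.quotientKerAlgEquivOfSurjective hf
  exact (quotient_mvPolynomial_int _).of_injective e.symm.toAddEquiv.toAddMonoidHom e.symm.injective

end GenericFreeness

section DedekindDomain

open IsDedekindDomain nonZeroDivisors

section Divisor

variable (C L : Type*) [CommRing C] [IsDedekindDomain C] [Field L] [Algebra C L]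
  [IsFractionRing C L]

/-- The divisor of a nonzero element of the fraction field of a Dedekind domain, recording the
exponents in the factorization of the principal fractional ideal it generates. -/
noncomputable def divisorHom : Additive Lˣ →+ (HeightOneSpectrum C →₀ ℤ) :=
  have spanSingleton_ne_zero (u : Lˣ) : FractionalIdeal.spanSingleton C⁰ (u : L) ≠ 0 :=
    FractionalIdeal.spanSingleton_ne_zero_iff.mpr u.ne_zero
  .mk' (fun u => .ofSupportFinite
    (fun v => FractionalIdeal.count L v (.spanSingleton C⁰ (u.toMul : L)))
    (FractionalIdeal.finite_factors (.spanSingleton C⁰ (u.toMul : L)))) fun a b => by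
      ext v
      change FractionalIdeal.count L v (.spanSingleton C⁰ ((a.toMul : L) * b.toMul)) = _
      rw [← FractionalIdeal.spanSingleton_mul_spanSingleton, FractionalIdeal.count_mul L v
        (spanSingleton_ne_zero a.toMul) (spanSingleton_ne_zero b.toMul)]
      rfl

variable {C L}

theorem exists_algebraMap_eq_of_divisorHom_eq_zero {u : Lˣ} (hu : divisorHom C L (.ofMul u) = 0) :
    ∃ c : C, algebraMap C L c = u := by
  have hcount (v : HeightOneSpectrum C) :
      FractionalIdeal.count L v (.spanSingleton C⁰ (u : L)) = 0 := DFunLike.congr_fun hu v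
  have hone : FractionalIdeal.spanSingleton C⁰ (u : L) = 1 := by
    rw [← FractionalIdeal.finprod_heightOneSpectrum_factorization' L
      (FractionalIdeal.spanSingleton_ne_zero_iff.mpr u.ne_zero)]
    simp [hcount]
  rw [← FractionalIdeal.mem_one_iff, ← hone]
  exact FractionalIdeal.mem_spanSingleton_self C⁰ _

end Divisor

theorem exists_divisorHom_isIntegral (A K L : Type*) [CommRing A] [IsDedekindDomain A] [Field K]
    [Algebra A K] [IsFractionRing A K] [Field L] [Algebra K L] [Algebra A L] [IsScalarTower A K L]
    [FiniteDimensional K L] [Algebra.IsSeparable K L] :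
    ∃ f : Additive Lˣ →+ (HeightOneSpectrum (integralClosure A L) →₀ ℤ),
      ∀ u : Lˣ, f (.ofMul u) = 0 → IsIntegral A (u : L) := by
  have := integralClosure.isDedekindDomain A K L
  have := integralClosure.isFractionRing_of_finite_extension (A := A) K L
  refine ⟨divisorHom (integralClosure A L) L, fun u hu => ?_⟩
  obtain ⟨c, hc⟩ := exists_algebraMap_eq_of_divisorHom_eq_zero hu
  exact hc ▸ c.2

theorem IsBoundedByCobounded.of_ker_le_range {A B F : Type*} [AddCommGroup A] [AddCommGroup B]
    [AddCommGroup F] [Module.Free ℤ F] (f : A →+ F) (h : IsBoundedByCobounded B) (j : B →+ A)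
    (hj : Function.Injective j) (hker : f.ker ≤ j.range) : IsBoundedByCobounded A :=
  of_ker f (of_hom_int one_ne_zero (.id F) fun x hx => (one_nsmul x).trans hx) <|
    h.of_injective ((AddMonoidHom.ofInjective hj).symm.toAddMonoidHom.comp
      (AddSubgroup.inclusion hker))
      ((AddMonoidHom.ofInjective hj).symm.injective.comp (AddSubgroup.inclusion_injective hker))

theorem IsBoundedByCobounded.units_of_injective {A B : Type*} [CommMonoid A] [CommMonoid B]
    (h : IsBoundedByCobounded (Additive Bˣ)) (f : A →* B) (hf : Function.Injective f) :
    IsBoundedByCobounded (Additive Aˣ) :=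
  h.of_injective (MonoidHom.toAdditive (Units.map f)) (Units.map_injective hf)

section NumberField

open NumberField NumberField.Units

theorem IsBoundedByCobounded.units_ringOfIntegers (K : Type*) [Field K] [NumberField K] :
    IsBoundedByCobounded (Additive (𝓞 K)ˣ) := by
  refine of_hom_int (F := Additive ((𝓞 K)ˣ ⧸ torsion K)) (torsionOrder_ne_zero K)
    (MonoidHom.toAdditive (QuotientGroup.mk' (torsion K))) fun u hu => ?_
  have hu : u.toMul ∈ torsion K := (QuotientGroup.eq_one_iff _).mp hu
  rw [← rootsOfUnity_eq_torsion] at hu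
  exact hu

theorem IsBoundedByCobounded.units_numberField (K : Type*) [Field K] [NumberField K] :
    IsBoundedByCobounded (Additive Kˣ) := by
  have hinj : Function.Injective (algebraMap (𝓞 K) K) := IsFractionRing.injective (𝓞 K) K
  refine of_ker_le_range (divisorHom (𝓞 K) K) (units_ringOfIntegers K)
    (MonoidHom.toAdditive (Units.map (algebraMap (𝓞 K) K : 𝓞 K →* K)))
    (Units.map_injective hinj) fun u hu => ?_
  obtain ⟨a, ha⟩ := exists_algebraMap_eq_of_divisorHom_eq_zero (u := u.toMul) hu
  obtain ⟨b, hb⟩ := exists_algebraMap_eq_of_divisorHom_eq_zero (u := u.toMul⁻¹) (neg_mem hu)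
  have hab : a * b = 1 := hinj <| by rw [map_mul, map_one, ha, hb, Units.mul_inv]
  exact ⟨.ofMul (.mkOfMulEqOne a b hab), Units.ext ha⟩

end NumberField

end DedekindDomain

section FunctionField

open Polynomial IntermediateField

theorem aeval_reverse_eq_aeval_inv_mul_pow {k K : Type*} [CommSemiring k] [Field K] [Algebra k K]
    {t : K} (ht : t ≠ 0) (q : k[X]) : aeval t q.reverse = aeval t⁻¹ q * t ^ q.natDegree := by
  let : Invertible t⁻¹ := invertibleOfNonzero (inv_ne_zero ht)
  have h := eval₂_reverse_mul_pow (algebraMap k K) t⁻¹ q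
  rw [invOf_eq_inv, inv_inv, ← aeval_def, ← aeval_def] at h
  rw [← h, mul_assoc, ← mul_pow, inv_mul_cancel₀ ht, one_pow, mul_one]

variable {k K L : Type*} [Field k] [Field K] [Algebra k K]

theorem isPrincipalIdealRing_adjoin_singleton (t : K) :
    IsPrincipalIdealRing (Algebra.adjoin k {t}) := by
  rw [Algebra.adjoin_singleton_eq_range_aeval]
  exact IsPrincipalIdealRing.of_surjective (aeval (R := k) t).rangeRestrict.toRingHom
    (aeval (R := k) t).rangeRestrict_surjective

theorem isFractionRing_adjoin_singleton {t : K} (htop : k⟮t⟯ = ⊤) :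
    IsFractionRing (Algebra.adjoin k {t}) K :=
  .of_field _ _ fun z => by
    obtain ⟨x, hx, y, hy, h⟩ := mem_adjoin_iff_div.mp (show z ∈ k⟮t⟯ from htop ▸ mem_top)
    exact ⟨⟨x, hx⟩, ⟨y, hy⟩, h⟩

theorem adjoin_inv_eq_top {t : K} (htop : k⟮t⟯ = ⊤) : k⟮t⁻¹⟯ = ⊤ := by
  rw [eq_top_iff, ← htop, adjoin_simple_le_iff]
  simpa using inv_mem (mem_adjoin_simple_self k t⁻¹)

theorem mem_range_algebraMap_of_mem_adjoin_of_mem_adjoin_inv {t : K} (ht : Transcendental k t)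
    {c : K} (h : c ∈ Algebra.adjoin k {t}) (h' : c ∈ Algebra.adjoin k {t⁻¹}) :
    c ∈ (algebraMap k K).range := by
  rw [Algebra.adjoin_singleton_eq_range_aeval] at h h'
  obtain ⟨p, rfl⟩ := h
  obtain ⟨q, hq : aeval t⁻¹ q = aeval t p⟩ := h'
  have hrev : q.reverse = p * X ^ q.natDegree := transcendental_iff_injective.mp ht <| by
    rw [aeval_reverse_eq_aeval_inv_mul_pow (by rintro rfl; exact ht isAlgebraic_zero), hq, map_mul,
      map_pow, aeval_X]
  have hp : p.natDegree = 0 := by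
    rcases eq_or_ne p 0 with rfl | hp
    · exact natDegree_zero
    · have := hrev ▸ q.reverse_natDegree_le
      rw [natDegree_mul_X_pow _ hp] at this
      omega
  rw [eq_C_of_natDegree_eq_zero hp]
  exact ⟨p.coeff 0, by simp⟩

section FiniteExtension

variable [Field L] [Algebra K L] [Algebra k L] [IsScalarTower k K L]

theorem isAlgebraic_of_isIntegral_adjoin {t : K} (ht : Transcendental k t) (htop : k⟮t⟯ = ⊤) {z : L}
    (h : IsIntegral (Algebra.adjoin k {t}) z) (h' : IsIntegral (Algebra.adjoin k {t⁻¹}) z) :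
    IsAlgebraic k z := by
  have := isPrincipalIdealRing_adjoin_singleton (k := k) t
  have := isPrincipalIdealRing_adjoin_singleton (k := k) t⁻¹
  have := isFractionRing_adjoin_singleton htop
  have := isFractionRing_adjoin_singleton (adjoin_inv_eq_top htop)
  have hlifts : minpoly K z ∈ lifts (algebraMap k K) := by
    refine (lifts_iff_coeff_lifts _).mpr fun n =>
      mem_range_algebraMap_of_mem_adjoin_of_mem_adjoin_inv ht ?_ ?_
    · rw [minpoly.isIntegrallyClosed_eq_field_fractions' K h, coeff_map]
      exact Subtype.property _
    · rw [minpoly.isIntegrallyClosed_eq_field_fractions' K h', coeff_map]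
      exact Subtype.property _
  obtain ⟨p, hp : p.map (algebraMap k K) = minpoly K z⟩ := hlifts
  refine ⟨p, ?_, ?_⟩
  · rintro rfl
    exact minpoly.ne_zero h.tower_top (hp ▸ Polynomial.map_zero _)
  · rw [← aeval_map_algebraMap K, hp, minpoly.aeval]

open RatFunc in
theorem finiteDimensional_algebraicClosure {t : K} (ht : Transcendental k t) (htop : k⟮t⟯ = ⊤)
    [FiniteDimensional K L] : FiniteDimensional k (algebraicClosure k L) := by
  let E := algebraicClosure k L
  let s : L := algebraMap K L t
  have hs : Transcendental k s := (transcendental_algebraMap_iff (algebraMap K L).injective).mpr ht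
  let : Algebra k[X] K := (aeval t).toAlgebra
  let : Algebra k[X] L := (aeval s).toAlgebra
  let : Algebra E[X] L := (aeval s).toAlgebra
  have : FaithfulSMul k[X] L :=
    (faithfulSMul_iff_algebraMap_injective _ _).mpr (transcendental_iff_injective.mp hs)
  have : FaithfulSMul E[X] L := (faithfulSMul_iff_algebraMap_injective _ _).mpr
    (transcendental_iff_injective.mp hs.algebraicClosure)
  have : IsScalarTower k[X] K L := .of_algebraMap_eq fun p => aeval_algebraMap_apply L t p
  have : IsFractionRing k[X] K :=
    have : FaithfulSMul k[X] K :=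
      (faithfulSMul_iff_algebraMap_injective _ _).mpr (transcendental_iff_injective.mp ht)
    .of_field _ _ fun z => (mem_adjoin_simple_iff k z).mp (show z ∈ k⟮t⟯ from htop ▸ mem_top)
  have : FunctionField k L := (functionField_iff k L K).mpr inferInstance
  let : Algebra k[X] E[X] := Polynomial.algebra k E
  have : IsScalarTower k[X] E[X] L :=
    .of_algebraMap_eq fun p => (aeval_map_algebraMap E s p).symm
  exact FunctionField.finiteDimensional_of_constantExtension (F := k) (E := E) L

theorem IsBoundedByCobounded.units_of_isSeparable {t : K} (ht : Transcendental k t)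
    (htop : k⟮t⟯ = ⊤) [FiniteDimensional K L] [Algebra.IsSeparable K L]
    (h : IsBoundedByCobounded (Additive (algebraicClosure k L)ˣ)) :
    IsBoundedByCobounded (Additive Lˣ) := by
  have := isPrincipalIdealRing_adjoin_singleton (k := k) t
  have := isPrincipalIdealRing_adjoin_singleton (k := k) t⁻¹
  have := isFractionRing_adjoin_singleton htop
  have := isFractionRing_adjoin_singleton (adjoin_inv_eq_top htop)
  obtain ⟨f, hf⟩ := exists_divisorHom_isIntegral (Algebra.adjoin k {t}) K L
  obtain ⟨g, hg⟩ := exists_divisorHom_isIntegral (Algebra.adjoin k {t⁻¹}) K L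
  refine of_ker_le_range (f.prod g) h
    (MonoidHom.toAdditive (Units.map (algebraMap (algebraicClosure k L) L)))
    (Units.map_injective Subtype.val_injective) fun u hu => ?_
  obtain ⟨huf, hug⟩ := Prod.mk_eq_zero.mp hu
  have halg : (u.toMul : L) ∈ algebraicClosure k L := mem_algebraicClosure_iff.mpr <|
    isAlgebraic_of_isIntegral_adjoin ht htop (hf u.toMul huf) (hg u.toMul hug)
  exact ⟨.ofMul (.mk0 ⟨_, halg⟩ fun h0 => u.toMul.ne_zero (congrArg Subtype.val h0)), Units.ext rfl⟩

end FiniteExtension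

end FunctionField

section FinitelyGeneratedFields

open IntermediateField nonZeroDivisors

/-- Every finite extension of `k` has a bounded-by-cobounded unit group. Quantifying over finite
extensions makes the property inherited by finitely generated extensions, one generator at a
time. -/
def HasBoundedByCoboundedUnits (k : Type u) [Field k] : Prop :=
  ∀ (L : Type u) [Field L] [Algebra k L] [FiniteDimensional k L],
    IsBoundedByCobounded (Additive Lˣ)

namespace HasBoundedByCoboundedUnits

theorem of_finite {k : Type u} [Field k] [Finite k] : HasBoundedByCoboundedUnits k := by
  intro L _ _ _
  have : Finite L := Module.finite_of_finite k
  have : Finite (Additive Lˣ) := inferInstanceAs (Finite Lˣ)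
  exact .of_finite

theorem of_numberField {k : Type u} [Field k] [NumberField k] : HasBoundedByCoboundedUnits k := by
  intro L _ _ _
  have : CharZero L := charZero_of_injective_algebraMap (algebraMap k L).injective
  have : FiniteDimensional ℚ L := FiniteDimensional.trans ℚ k L
  have : NumberField L := ⟨⟩
  exact .units_numberField L

theorem of_finiteDimensional {k K : Type u} [Field k] [Field K] [Algebra k K]
    [FiniteDimensional k K] (hk : HasBoundedByCoboundedUnits k) :
    HasBoundedByCoboundedUnits K := by
  intro L _ _ _
  let : Algebra k L := ((algebraMap K L).comp (algebraMap k K)).toAlgebra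
  have : IsScalarTower k K L := .of_algebraMap_eq fun _ => rfl
  have : FiniteDimensional k L := FiniteDimensional.trans k K L
  exact hk L

theorem of_transcendental {k K : Type u} [Field k] [Field K] [Algebra k K]
    (hk : HasBoundedByCoboundedUnits k) {t : K} (ht : Transcendental k t) (htop : k⟮t⟯ = ⊤) :
    HasBoundedByCoboundedUnits K := by
  intro L _ _ _
  let S := separableClosure K L
  let : Algebra k S := ((algebraMap K S).comp (algebraMap k K)).toAlgebra
  have : IsScalarTower k K S := .of_algebraMap_eq fun _ => rfl
  have : FiniteDimensional k (algebraicClosure k S) := finiteDimensional_algebraicClosure ht htop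
  have hS : IsBoundedByCobounded (Additive Sˣ) :=
    .units_of_isSeparable ht htop (hk (algebraicClosure k S))
  -- An iterate of Frobenius embeds `L` into its separable part, so inseparability costs nothing.
  let frob : L →+* S := IsPurelyInseparable.iterateFrobenius S L (ringExpChar K) le_rfl
  exact hS.units_of_injective (frob : L →* S) frob.injective

theorem adjoin_simple {k E : Type u} [Field k] [Field E] [Algebra k E]
    (hk : HasBoundedByCoboundedUnits k) (x : E) : HasBoundedByCoboundedUnits k⟮x⟯ := by
  by_cases hx : IsAlgebraic k x
  · have := adjoin.finiteDimensional hx.isIntegral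
    exact hk.of_finiteDimensional
  · refine hk.of_transcendental (t := AdjoinSimple.gen k x) (fun h => hx ?_) ?_
    · simpa using h.algebraMap (A := E)
    · apply map_injective k⟮x⟯.val
      rw [adjoin_map, Set.image_singleton, ← AlgHom.fieldRange_eq_map, fieldRange_val]
      rfl

end HasBoundedByCoboundedUnits

namespace IsBoundedByCobounded

theorem units_of_fg {F : Type*} {K : Type u} [Field F] [Field K] [Algebra F K]
    (hF : HasBoundedByCoboundedUnits (⊥ : IntermediateField F K))
    (h : (⊤ : IntermediateField F K).FG) : IsBoundedByCobounded (Additive Kˣ) := by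
  have htop : HasBoundedByCoboundedUnits (⊤ : IntermediateField F K) :=
    induction_on_adjoin_fg (fun E : IntermediateField F K => HasBoundedByCoboundedUnits E) hF
      (fun E x hE => hE.adjoin_simple x) ⊤ h
  have : FiniteDimensional (⊤ : IntermediateField F K) K :=
    .of_surjective (Algebra.linearMap _ K) fun x => ⟨⟨x, mem_top⟩, rfl⟩
  exact htop K

theorem units_of_essFiniteType_int (K : Type*) [Field K] [Algebra ℤ K]
    [Algebra.EssFiniteType ℤ K] : IsBoundedByCobounded (Additive Kˣ) := by
  obtain rfl := Subsingleton.elim ‹Algebra ℤ K› (Ring.toIntAlgebra K)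
  obtain ⟨p, _⟩ := CharP.exists K
  rcases CharP.char_is_prime_or_zero K p with hp | rfl
  · have := Fact.mk hp
    let := ZMod.algebra K p
    have : Algebra.EssFiniteType (ZMod p) K := .of_comp ℤ (ZMod p) K
    have : Finite (⊥ : IntermediateField (ZMod p) K) := Module.finite_of_finite (ZMod p)
    exact units_of_fg .of_finite (fg_top (ZMod p) K)
  · have : CharZero K := CharP.charP_to_charZero K
    have : Algebra.EssFiniteType ℚ K := .of_comp ℤ ℚ K
    have : FiniteDimensional ℚ (⊥ : IntermediateField ℚ K) := inferInstance
    have : NumberField (⊥ : IntermediateField ℚ K) := ⟨⟩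
    exact units_of_fg .of_numberField (fg_top ℚ K)

theorem units_of_isDomain (D : Type*) [CommRing D] [IsDomain D] [hD : Algebra.FiniteType ℤ D] :
    IsBoundedByCobounded (Additive Dˣ) := by
  have : Algebra.EssFiniteType D (FractionRing D) := .of_isLocalization _ D⁰
  have : Algebra.EssFiniteType ℤ (FractionRing D) := .comp ℤ D (FractionRing D)
  exact (units_of_essFiniteType_int (FractionRing D)).units_of_injective
    (algebraMap D (FractionRing D) : D →* FractionRing D) (IsFractionRing.injective D _)

end IsBoundedByCobounded

end FinitelyGeneratedFields

section FinitelyGeneratedRings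

namespace IsBoundedByCobounded

-- On units `≡ 1` modulo a square-zero ideal, `u ↦ u - 1` turns products into sums.
theorem units_of_ker_mul_eq_zero {A B : Type*} [CommRing A] [CommRing B]
    (hA : IsBoundedByCobounded A) (hB : IsBoundedByCobounded (Additive Bˣ)) (f : A →+* B)
    (hf : ∀ x y, f x = 0 → f y = 0 → x * y = 0) : IsBoundedByCobounded (Additive Aˣ) := by
  let F : Additive Aˣ →+ Additive Bˣ := MonoidHom.toAdditive (Units.map (f : A →* B))
  have hker (u : F.ker) : f ((u : Additive Aˣ).toMul - 1 : A) = 0 := by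
    have hu : f ((u : Additive Aˣ).toMul : A) = 1 :=
      congrArg (fun x : Additive Bˣ => (x.toMul : B)) u.2
    rw [map_sub, map_one, hu, sub_self]
  let subOne : F.ker →+ A := .mk' (fun u => ((u : Additive Aˣ).toMul : A) - 1) fun u v => by
    rw [AddSubgroup.coe_add, toMul_add, Units.val_mul]
    linear_combination hf _ _ (hker u) (hker v)
  exact of_ker F hB <| hA.of_injective subOne fun u v huv =>
    Subtype.ext (Units.ext (sub_left_injective huv))

theorem units_of_isNilpotent {A : Type*} [CommRing A] [Algebra.FiniteType ℤ A] (I : Ideal A)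
    (hI : IsNilpotent I) (h : IsBoundedByCobounded (Additive (A ⧸ I)ˣ)) :
    IsBoundedByCobounded (Additive Aˣ) := by
  refine Ideal.IsNilpotent.induction_on (S := A) (P := fun S _ I => Algebra.FiniteType ℤ S →
    IsBoundedByCobounded (Additive (S ⧸ I)ˣ) → IsBoundedByCobounded (Additive Sˣ)) I hI
    (fun S _ I hsq hS h => ?_) (fun S _ I J hIJ hI hJ hS h => ?_) ‹_› h
  · refine units_of_ker_mul_eq_zero (of_finiteType_int S) h (Ideal.Quotient.mk I)
      fun x y hx hy => ?_
    rw [Ideal.Quotient.eq_zero_iff_mem] at hx hy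
    simpa only [← sq, hsq, Ideal.mem_bot] using Ideal.mul_mem_mul hx hy
  · let e := DoubleQuot.quotQuotEquivQuotOfLE hIJ
    exact hI hS (hJ (.of_surjective (Ideal.Quotient.mk I).toIntAlgHom Ideal.Quotient.mk_surjective)
      (h.units_of_injective (e : _ →* S ⧸ J) e.injective))

theorem units_of_finiteType_int (A : Type*) [CommRing A] [Algebra.FiniteType ℤ A] :
    IsBoundedByCobounded (Additive Aˣ) := by
  have : IsNoetherianRing A := Algebra.FiniteType.isNoetherianRing ℤ A
  have : Finite (minimalPrimes A) := minimalPrimes.finite_of_isNoetherianRing A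
  let f : A →+* ∀ p : minimalPrimes A, A ⧸ p.1 := RingHom.pi fun p => Ideal.Quotient.mk p.1
  have hker : RingHom.ker f = nilradical A := by
    ext a
    rw [nilradical, ← Ideal.sInf_minimalPrimes, Submodule.mem_sInf, RingHom.mem_ker, funext_iff]
    exact Subtype.forall.trans (forall₂_congr fun p _ => Ideal.Quotient.eq_zero_iff_mem)
  have hprod : IsBoundedByCobounded (∀ p : minimalPrimes A, Additive (A ⧸ p.1)ˣ) := .pi fun p =>
    have : p.1.IsPrime := p.2.1.1
    units_of_isDomain (A ⧸ p.1)
      (hD := .of_surjective (Ideal.Quotient.mk p.1).toIntAlgHom Ideal.Quotient.mk_surjective)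
  have hpi : IsBoundedByCobounded (Additive (∀ p : minimalPrimes A, A ⧸ p.1)ˣ) :=
    hprod.of_injective (MonoidHom.toAdditive (MulEquiv.piUnits.toMonoidHom))
      MulEquiv.piUnits.injective
  refine units_of_isNilpotent (RingHom.ker f) ?_ <|
    hpi.units_of_injective (f.kerLift : A ⧸ RingHom.ker f →* _) f.kerLift_injective
  exact hker ▸ IsNoetherianRing.isNilpotent_nilradical A

end IsBoundedByCobounded

theorem countable_of_finiteType (R A : Type*) [CommRing R] [Countable R] [CommRing A] [Algebra R A]
    [hA : Algebra.FiniteType R A] : Countable A := by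
  obtain ⟨n, f, hf⟩ := Algebra.FiniteType.iff_quotient_mvPolynomial''.mp hA
  have : Countable (MvPolynomial (Fin n) R) :=
    (AddMonoidAlgebra.coeffAddEquiv (R := R) (M := Fin n →₀ ℕ)).injective.countable
  exact hf.countable

end FinitelyGeneratedRings

open scoped IsMulCommutative in
theorem IsArithmeticallyLinear.exists_injective_units {H : Type u} [AddCommGroup H]
    (h : IsArithmeticallyLinear.{u, v} (Multiplicative H)) :
    ∃ (A : Type v) (_ : CommRing A) (_ : Algebra.FiniteType ℤ A) (f : H →+ Additive Aˣ),
      Function.Injective f := by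
  obtain ⟨n, C, _, hC, f, hf⟩ := h
  have : IsNoetherianRing C := Algebra.FiniteType.isNoetherianRing ℤ C
  let M := Matrix (Fin n) (Fin n) C
  let A := Algebra.adjoin C (Set.range fun x => (f x : M))
  have : IsMulCommutative A := Algebra.isMulCommutative_adjoin C <| by
    rintro _ ⟨x, rfl⟩ _ ⟨y, rfl⟩
    exact congrArg Units.val (((Commute.all x y).map f).eq)
  have : Module.Finite C A := inferInstanceAs (Module.Finite C (Subalgebra.toSubmodule A))
  have hA : Algebra.FiniteType ℤ A := hC.trans inferInstance
  let g : Multiplicative H →* A :=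
    ((Units.coeHom M).comp f).codRestrict A fun x => Algebra.subset_adjoin ⟨x, rfl⟩
  refine ⟨A, inferInstance, hA.of_surjective (RingHom.id A).toIntAlgHom Function.surjective_id,
    MonoidHom.toAdditiveRight g.toHomUnits, fun x y hxy => ?_⟩
  have hg : g (.ofAdd x) = g (.ofAdd y) := congrArg (fun u : Additive Aˣ => (u.toMul : A)) hxy
  exact Multiplicative.ofAdd.injective (hf (Units.ext (congrArg Subtype.val hg)))

theorem mainTheorem8 (H : Type u) [AddCommGroup H] :
    IsArithmeticallyLinear.{u, v} (Multiplicative H) ↔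
      Countable H ∧ IsBoundedTimesCobounded H := by
  refine ⟨fun h => ?_, fun ⟨_, h⟩ => h.isArithmeticallyLinear⟩
  obtain ⟨A, _, _, f, hf⟩ := h.exists_injective_units
  have : Countable A := countable_of_finiteType ℤ A
  have : Countable Aˣ := Units.val_injective.countable
  have : Countable H := (Additive.toMul.injective.comp hf).countable
  exact ⟨this, ((IsBoundedByCobounded.units_of_finiteType_int A).of_injective f
    hf).isBoundedTimesCobounded⟩
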